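/- Let $\mathbf{P}_0$ be the category of finite rooted posets (finite posets with a greatest element $\rho(P)$, the root) and open maps (monotone maps $h:Q\to P$ such that whenever $p\le h(q)$ there is $q'\le q$ with $h(q')=p$). For a finite poset $L$, let $h_L$ be the presheaf on $\mathbf{P}_0$ sending $P$ to the set of monotone maps $P\to L$, with open maps acting by precomposition. For monotone $u:P\to L$, $v:Q\to L$ write $u\sim_0 v$ if $u(\rho(P))=v(\rho(Q))$ and, for $n\geq 1$, $u\sim_n v$ if Player 2 has a winning strategy in the following $n$-round game: in each round Player 1 chooses a point of $P$ or of $Q$ and Player 2 answers with a point of the other poset; after a round with points $p\in P$, $q\in Q$, the points $p'\in P$, $q'\in Q$ of the next round must satisfy $p'\le p$ and $q'\le q$; Player 2 wins if $u(p)=v(q)$ for the points $p,q$ of every round. Let $\mathcal{S}(h_L)$ be the set of subpresheaves $S$ of $h_L$ for which there is $n\ge 0$ such that $u\in S_P$ and $u\sim_n v$ imply $v\in S_Q$, for all $u:P\to L$ and $v:Q\to L$ in $h_L$; it is a sub-Heyting algebra of the Heyting algebra of all subpresheaves of $h_L$. For a finite poset $M$ let $\mathcal{D}(M)$ be the lattice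 of downward closed subsets of $M$ (a finite Heyting algebra), for a monotone map $f:M\to L$ let $\mathcal{D}(f)=f^{-1}:\mathcal{D}(L)\to\mathcal{D}(M)$, and let $$\iota_L:\mathcal{D}(L)\to\mathcal{S}(h_L),\qquad \iota_L(d)_P=\{u:P\to L\mid u(\rho(P))\in d\},$$ $$ev_f:\mathcal{S}(h_L)\to\mathcal{D}(M),\qquad ev_f(X)=\{p\in M\mid f_p\in X_{\downarrow p}\},$$ where $f_p$ is the restriction of $f$ to $\downarrow p=\{q\in M\mid q\le p\}$. Proposition. Let $L$ be a finite poset. For every finite poset $M$ and every monotone map $f:M\to L$, the map $ev_f$ is a Heyting algebra morphism and $ev_f\circ\iota_L=\mathcal{D}(f)$. Consequently $\mathcal{S}(h_L)$, together with the bounded lattice embedding $\iota_L$, is the free Heyting algebra generated by the finite distributive lattice $\mathcal{D}(L)$: $\iota_L$ is an injective bounded lattice homomorphism, and for every Heyting algebra $H$ and every bounded lattice homomorphism $g:\mathcal{D}(L)\to H$ there is a unique Heyting algebra morphism $\varphi:\mathcal{S}(h_L)\to H$ with $\varphi\circ\iota_L=g$. -/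

import Mathlib

open CategoryTheory Opposite

universe u v w

namespace HeytingEval

/-- A finite rooted poset: a finite partial order with a greatest element `⊤` (its root). -/
structure FinRootedPoset : Type (v + 1) where
  carrier : Type v
  [partialOrder : PartialOrder carrier]
  [orderTop : OrderTop carrier]
  [finite : Finite carrier]

instance : CoeSort FinRootedPoset.{v} (Type v) := ⟨FinRootedPoset.carrier⟩

attribute [instance] FinRootedPoset.partialOrder FinRootedPoset.orderTop FinRootedPoset.finite

/-- An open map: a monotone map `f` such that whenever `q ≤ f p` there is `p' ≤ p` with
`f p' = q`. -/
@[ext]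
structure OpenMap (P Q : FinRootedPoset.{v}) where
  toOrderHom : P →o Q
  isOpen : ∀ (p : P) (q : Q), q ≤ toOrderHom p → ∃ p' : P, p' ≤ p ∧ toOrderHom p' = q

/-- The category of finite rooted posets and open maps. -/
instance : Category FinRootedPoset.{v} where
  Hom P Q := OpenMap P Q
  id P := ⟨OrderHom.id, fun _ q h => ⟨q, h, rfl⟩⟩
  comp {P Q R} f g := ⟨g.toOrderHom.comp f.toOrderHom, by
    intro p r h
    obtain ⟨q, hq, rfl⟩ := g.isOpen _ _ h
    obtain ⟨p', hp', rfl⟩ := f.isOpen _ _ hq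
    exact ⟨p', hp', rfl⟩⟩

/-- The presheaf `h_L` on finite rooted posets and open maps: `h_L(P)` is the set of monotone maps
(`L`-evaluations) `P → L`, and open maps act by precomposition. -/
def evalPresheaf (L : Type u) [PartialOrder L] : FinRootedPoset.{v}ᵒᵖ ⥤ Type (max u v) where
  obj P := P.unop →o L
  map h := ↾fun a => OrderHom.comp a h.unop.toOrderHom
  map_id _ := rfl
  map_comp _ _ := rfl

/-- For posets with points `p`, `q` last played: Player 2 can win the remaining `n` rounds.
In each round Player 1 picks a point below the last point on one side, and Player 2 answers with
a point below the last point on the other side having the same label. -/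
def Wins {P : Type*} {Q : Type*} {L : Type*} [Preorder P] [Preorder Q] [Preorder L]
    (a : P →o L) (b : Q →o L) : ℕ → P → Q → Prop
  | 0, _, _ => True
  | n + 1, p, q =>
      (∀ p' ≤ p, ∃ q' ≤ q, a p' = b q' ∧ Wins a b n p' q') ∧
      (∀ q' ≤ q, ∃ p' ≤ p, a p' = b q' ∧ Wins a b n p' q')

/-- Bounded bisimulation `∼_n`. For `n = 0`: the labels of the roots coincide. For `n > 0`:
Player 2 wins the `n`-round game, whose first moves are unrestricted (all points lie below the
roots). -/
def Bisim {L : Type u} [PartialOrder L] (n : ℕ) {P Q : FinRootedPoset.{v}}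
    (a : P →o L) (b : Q →o L) : Prop :=
  match n with
  | 0 => a ⊤ = b ⊤
  | n + 1 => Wins a b (n + 1) ⊤ ⊤

/-- `n` is a b-index of the subpresheaf `S` of `h_L`: `S` is closed under `∼_n`. -/
def HasBIndex {L : Type u} [PartialOrder L] (n : ℕ)
    (S : Subfunctor (evalPresheaf.{u, v} L)) : Prop :=
  ∀ (P Q : FinRootedPoset.{v}) (a : P →o L) (b : Q →o L),
    a ∈ S.obj (op P) → Bisim n a b → b ∈ S.obj (op Q)

section Game

variable {P Q L : Type*} [PartialOrder P] [PartialOrder Q] [PartialOrder L]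

lemma Wins.symm {a : P →o L} {b : Q →o L} {n : ℕ} {p : P} {q : Q} (h : Wins a b n p q) :
    Wins b a n q p := by
  induction n generalizing p q with
  | zero => trivial
  | succ n ih =>
    refine ⟨fun q' hq' => ?_, fun p' hp' => ?_⟩
    · obtain ⟨p', hp', e, hw⟩ := h.2 q' hq'
      exact ⟨p', hp', e.symm, ih hw⟩
    · obtain ⟨q', hq', e, hw⟩ := h.1 p' hp'
      exact ⟨q', hq', e.symm, ih hw⟩

lemma Wins.pred {a : P →o L} {b : Q →o L} {n : ℕ} {p : P} {q : Q} (h : Wins a b (n + 1) p q) :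
    Wins a b n p q := by
  induction n generalizing p q with
  | zero => trivial
  | succ n ih =>
    refine ⟨fun p' hp' => ?_, fun q' hq' => ?_⟩
    · obtain ⟨q', hq', e, hw⟩ := h.1 p' hp'
      exact ⟨q', hq', e, ih hw⟩
    · obtain ⟨p', hp', e, hw⟩ := h.2 q' hq'
      exact ⟨p', hp', e, ih hw⟩

lemma Wins.label_eq {a : P →o L} {b : Q →o L} {n : ℕ} {p : P} {q : Q}
    (h : Wins a b (n + 1) p q) : a p = b q := by
  obtain ⟨q', hq', e, -⟩ := h.1 p le_rfl
  obtain ⟨p', hp', e', -⟩ := h.2 q le_rfl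
  exact le_antisymm (e ▸ b.monotone hq') (e' ▸ a.monotone hp')

end Game

lemma wins_comp_iff {L : Type u} [PartialOrder L] {P P' Q Q' : FinRootedPoset.{v}}
    (h : P' ⟶ P) (k : Q' ⟶ Q) (a : P →o L) (b : Q →o L) (n : ℕ) (p : P') (q : Q') :
    Wins (a.comp h.toOrderHom) (b.comp k.toOrderHom) n p q ↔
      Wins a b n (h.toOrderHom p) (k.toOrderHom q) := by
  induction n generalizing p q with
  | zero => exact Iff.rfl
  | succ n ih =>
    refine ⟨fun H => ⟨fun p' hp' => ?_, fun q' hq' => ?_⟩,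
      fun H => ⟨fun p' hp' => ?_, fun q' hq' => ?_⟩⟩
    · obtain ⟨x, hx, rfl⟩ := h.isOpen _ _ hp'
      obtain ⟨y, hy, e, hw⟩ := H.1 x hx
      exact ⟨k.toOrderHom y, k.toOrderHom.monotone hy, e, (ih _ _).1 hw⟩
    · obtain ⟨y, hy, rfl⟩ := k.isOpen _ _ hq'
      obtain ⟨x, hx, e, hw⟩ := H.2 y hy
      exact ⟨h.toOrderHom x, h.toOrderHom.monotone hx, e, (ih _ _).1 hw⟩
    · obtain ⟨y, hy, e, hw⟩ := H.1 _ (h.toOrderHom.monotone hp')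
      obtain ⟨y', hy', rfl⟩ := k.isOpen _ _ hy
      exact ⟨y', hy', e, (ih _ _).2 hw⟩
    · obtain ⟨x, hx, e, hw⟩ := H.2 _ (k.toOrderHom.monotone hq')
      obtain ⟨x', hx', rfl⟩ := h.isOpen _ _ hx
      exact ⟨x', hx', e, (ih _ _).2 hw⟩

section Bisim

variable {L : Type u} [PartialOrder L] {P Q : FinRootedPoset.{v}}

lemma bisim_iff {n : ℕ} {a : P →o L} {b : Q →o L} :
    Bisim n a b ↔ a ⊤ = b ⊤ ∧ Wins a b n ⊤ ⊤ := by
  cases n with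
  | zero => exact ⟨fun h => ⟨h, trivial⟩, fun h => h.1⟩
  | succ n => exact ⟨fun h => ⟨Wins.label_eq h, h⟩, fun h => h.2⟩

lemma Bisim.symm {n : ℕ} {a : P →o L} {b : Q →o L} (h : Bisim n a b) : Bisim n b a := by
  rw [bisim_iff] at h ⊢
  exact ⟨h.1.symm, h.2.symm⟩

lemma Bisim.mono {m n : ℕ} (hmn : m ≤ n) {a : P →o L} {b : Q →o L} (h : Bisim n a b) :
    Bisim m a b := by
  induction hmn with
  | refl => exact h
  | step _ ih =>
    rw [bisim_iff] at h
    exact ih (bisim_iff.2 ⟨h.1, h.2.pred⟩)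

lemma HasBIndex.mono {m n : ℕ} (hmn : m ≤ n) {S : Subfunctor (evalPresheaf.{u, v} L)}
    (h : HasBIndex m S) : HasBIndex n S :=
  fun _ _ _ _ ha hab => h _ _ _ _ ha (hab.mono hmn)

end Bisim

/-- The principal downset `↓p` of a finite poset, as a finite rooted poset with root `p`. -/
def down {M : Type v} [PartialOrder M] [Finite M] (p : M) : FinRootedPoset.{v} where
  carrier := Set.Iic p

/-- The inclusion `↓q ⊆ ↓p` for `q ≤ p`, which is open. -/
def downIncl {M : Type v} [PartialOrder M] [Finite M] {q p : M} (h : q ≤ p) :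
    down q ⟶ down p :=
  OpenMap.mk ⟨fun x => ⟨x.1, le_trans x.2 h⟩, fun _ _ hxy => hxy⟩
    (fun x y hyx => ⟨⟨y.1, le_trans hyx x.2⟩, hyx, rfl⟩)

/-- The restriction `f_p : ↓p → L` of `f : M → L`. -/
def restr {M : Type v} [PartialOrder M] [Finite M] {L : Type u} [PartialOrder L]
    (f : M →o L) (p : M) : down p →o L where
  toFun x := f x.1
  monotone' _ _ hxy := f.monotone hxy

/-- The inclusion of `↓p` into a finite rooted poset, which is open. -/
def downInclTop {P : FinRootedPoset.{v}} (p : P) : down p ⟶ P :=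
  OpenMap.mk ⟨fun x => x.1, fun _ _ hxy => hxy⟩
    (fun x y hyx => ⟨⟨y, le_trans hyx x.2⟩, hyx, rfl⟩)

/-- The Heyting algebra of subfunctors of a `Type`-valued functor. The lattice structure is
Mathlib's (componentwise unions and intersections). -/
instance subfunctorHeyting {C : Type*} [Category* C] (F : C ⥤ Type w) :
    HeytingAlgebra (Subfunctor F) where
  himp S T :=
    { obj U := {x | ∀ (V : C) (i : U ⟶ V), F.map i x ∈ S.obj V → F.map i x ∈ T.obj V}
      map {U V} i x hx W j := by
        have := hx W (i ≫ j)
        simpa using this }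
  le_himp_iff A S T := by
    constructor
    · intro h U x hx
      have := h U hx.1 U (𝟙 U)
      simp only [Functor.map_id_apply] at this
      exact this hx.2
    · intro h U x hx V i hi
      exact h V ⟨A.map i hx, hi⟩
  compl S :=
    { obj U := {x | ∀ (V : C) (i : U ⟶ V), F.map i x ∉ S.obj V}
      map {U V} i x hx W j := by
        have := hx W (i ≫ j)
        simpa using this }
  himp_bot _ := rfl

section SubHeyting

variable {L : Type u} [PartialOrder L]

lemma hasBIndex_top : HasBIndex 0 (⊤ : Subfunctor (evalPresheaf.{u, v} L)) :=
  fun _ _ _ _ _ _ => trivial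

lemma hasBIndex_bot : HasBIndex 0 (⊥ : Subfunctor (evalPresheaf.{u, v} L)) :=
  fun _ _ _ _ h _ => h

lemma HasBIndex.sup {n : ℕ} {S T : Subfunctor (evalPresheaf.{u, v} L)} (hS : HasBIndex n S)
    (hT : HasBIndex n T) : HasBIndex n (S ⊔ T) :=
  fun _ _ _ _ h hab => h.imp (fun h => hS _ _ _ _ h hab) (fun h => hT _ _ _ _ h hab)

lemma HasBIndex.inf {n : ℕ} {S T : Subfunctor (evalPresheaf.{u, v} L)} (hS : HasBIndex n S)
    (hT : HasBIndex n T) : HasBIndex n (S ⊓ T) :=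
  fun _ _ _ _ h hab => ⟨hS _ _ _ _ h.1 hab, hT _ _ _ _ h.2 hab⟩

lemma HasBIndex.himp {n : ℕ} {S T : Subfunctor (evalPresheaf.{u, v} L)} (hS : HasBIndex n S)
    (hT : HasBIndex n T) : HasBIndex (n + 1) (S ⇨ T) := by
  intro P Q a b ha hab R i hi
  have hw : Wins a b (n + 1) ⊤ ⊤ := hab
  let k : R.unop ⟶ Q := i.unop
  obtain ⟨p, -, e, hp⟩ := hw.2 (k.toOrderHom ⊤) le_top
  have key : Bisim n (a.comp (downInclTop p).toOrderHom) (b.comp k.toOrderHom) :=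
    bisim_iff.2 ⟨e, (wins_comp_iff (downInclTop p) k a b n ⊤ ⊤).2 hp⟩
  exact hT _ _ _ _ (ha (op (down p)) (downInclTop p).op (hS _ _ _ _ hi key.symm)) key

/-- `S(h_L)`: the subpresheaves of `h_L` having a b-index. -/
def BSub (L : Type u) [PartialOrder L] : Type (max u (v + 1)) :=
  {S : Subfunctor (evalPresheaf.{u, v} L) // ∃ n, HasBIndex n S}

lemma exists_common {S T : Subfunctor (evalPresheaf.{u, v} L)} (hS : ∃ n, HasBIndex n S)
    (hT : ∃ n, HasBIndex n T) : ∃ n, HasBIndex n S ∧ HasBIndex n T := by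
  obtain ⟨m, hm⟩ := hS
  obtain ⟨n, hn⟩ := hT
  exact ⟨max m n, hm.mono (le_max_left _ _), hn.mono (le_max_right _ _)⟩

instance : PartialOrder (BSub.{u, v} L) := inferInstanceAs (PartialOrder (Subtype _))
instance : Top (BSub.{u, v} L) := ⟨⟨⊤, 0, hasBIndex_top⟩⟩
instance : Bot (BSub.{u, v} L) := ⟨⟨⊥, 0, hasBIndex_bot⟩⟩
instance : Max (BSub.{u, v} L) :=
  ⟨fun S T => ⟨S.1 ⊔ T.1, (exists_common S.2 T.2).imp fun _ h => h.1.sup h.2⟩⟩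
instance : Min (BSub.{u, v} L) :=
  ⟨fun S T => ⟨S.1 ⊓ T.1, (exists_common S.2 T.2).imp fun _ h => h.1.inf h.2⟩⟩
instance : HImp (BSub.{u, v} L) :=
  ⟨fun S T => ⟨S.1 ⇨ T.1, (exists_common S.2 T.2).elim fun n h => ⟨n + 1, h.1.himp h.2⟩⟩⟩
instance : Compl (BSub.{u, v} L) := ⟨fun S => S ⇨ ⊥⟩

/-- `S(h_L)` as a sub-Heyting algebra of the Heyting algebra of subpresheaves of `h_L`. -/
instance : HeytingAlgebra (BSub.{u, v} L) :=
  Function.Injective.heytingAlgebra Subtype.val Subtype.val_injective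
    Iff.rfl Iff.rfl (fun _ _ => rfl) (fun _ _ => rfl) rfl rfl
    (fun S => (himp_bot S.1)) (fun _ _ => rfl)

end SubHeyting

/-- The bounded lattice homomorphism `ι_L : D(L) → S(h_L)`,
`ι_L(d)_P = {u : P → L | u(ρ(P)) ∈ d}`. Here `D(L) = LowerSet L`. -/
def iota (L : Type u) [PartialOrder L] : BoundedLatticeHom (LowerSet L) (BSub.{u, v} L) where
  toFun d :=
    ⟨{ obj P := {a : P.unop →o L | a ⊤ ∈ d}
       map _ a ha := d.lower (OrderHom.monotone a le_top) ha }, 0,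
      fun _ _ a b (ha : a ⊤ ∈ d) (hab : a ⊤ = b ⊤) => show b ⊤ ∈ d from hab ▸ ha⟩
  map_sup' _ _ := rfl
  map_inf' _ _ := rfl
  map_top' := rfl
  map_bot' := rfl

/-- `D(f) = f⁻¹ : D(L) → D(M)` for a monotone map `f : M → L`. -/
def downsetMap {M : Type v} [PartialOrder M] {L : Type u} [PartialOrder L] (f : M →o L) :
    BoundedLatticeHom (LowerSet L) (LowerSet M) where
  toFun d := ⟨f ⁻¹' d, d.lower.preimage f.monotone⟩
  map_sup' _ _ := rfl
  map_inf' _ _ := rfl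
  map_top' := rfl
  map_bot' := rfl

/-- `ev_f : S(h_L) → D(M)`, `ev_f(X) = {p ∈ M | f_p ∈ X_{↓p}}`. -/
def ev {M : Type v} [PartialOrder M] [Finite M] {L : Type u} [PartialOrder L] (f : M →o L)
    (X : BSub.{u, v} L) : LowerSet M where
  carrier := {p | restr f p ∈ X.1.obj (op (down p))}
  lower' _ _ hqp hp := X.1.map (downIncl hqp).op hp

end HeytingEval

/-! Freeness reduces to two facts about Heyting terms over D(L). Generation (`exists_eval_iota_eq`):
every element of S(h_L) is the value of a term under `iota`. Conservativity
(`eval_le_eval_of_eval_iota_le`): an inequality of terms true under `iota` is true under every g :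
D(L) → H. A morphism extending g must send the `iota`-value of t to the g-value of t; conservativity
makes this well defined, generation makes it total and unique.

Generation: as L is finite, ∼_n has finitely many classes. These are coded by elements of a finite
poset, and lying below, or not above, a given code is expressed by a term, by induction on n.

Conservativity: an inequality failing in H already fails in D(M) for a finite M and some f : M → L,
found by filtrating the prime ideals of H. But `ev f` is a Heyting morphism extending D(f), so it
carries the inequality from S(h_L) to D(M).

That `ev f` preserves implication rests on the b-index: for an open map k, the ∼_n-class of f ∘ k at
the root is that of f at the image of the root, so only this image matters (`mem_ev_comp`). -/

namespace HeytingEval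

/-! ### Heyting terms -/

/-- Terms of the language of lattices with a Heyting implication, over generators in `A`. -/
inductive HTerm (A : Type u) : Type u
  | of : A → HTerm A
  | inf : HTerm A → HTerm A → HTerm A
  | sup : HTerm A → HTerm A → HTerm A
  | himp : HTerm A → HTerm A → HTerm A

namespace HTerm

variable {A : Type u}

/-- The value of a term under an assignment of the generators. -/
def eval {H : Type*} [HeytingAlgebra H] (g : A → H) : HTerm A → H
  | of a => g a
  | inf s t => eval g s ⊓ eval g t
  | sup s t => eval g s ⊔ eval g t
  | himp s t => eval g s ⇨ eval g t

lemma map_eval {H K F : Type*} [HeytingAlgebra H] [HeytingAlgebra K] [FunLike F H K]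
    [HeytingHomClass F H K] (φ : F) (g : A → H) (t : HTerm A) :
    φ (t.eval g) = t.eval (fun a => φ (g a)) := by
  induction t with
  | of a => rfl
  | inf s t hs ht => simp only [eval, map_inf, hs, ht]
  | sup s t hs ht => simp only [eval, map_sup, hs, ht]
  | himp s t hs ht => simp only [eval, map_himp, hs, ht]

/-- The subterms of a term. -/
def subterms : HTerm A → Set (HTerm A)
  | of a => {of a}
  | inf s t => {inf s t} ∪ (subterms s ∪ subterms t)
  | sup s t => {sup s t} ∪ (subterms s ∪ subterms t)
  | himp s t => {himp s t} ∪ (subterms s ∪ subterms t)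

lemma finite_subterms (t : HTerm A) : t.subterms.Finite := by
  induction t with
  | of a => exact Set.finite_singleton _
  | inf s t hs ht => exact (Set.finite_singleton _).union (hs.union ht)
  | sup s t hs ht => exact (Set.finite_singleton _).union (hs.union ht)
  | himp s t hs ht => exact (Set.finite_singleton _).union (hs.union ht)

lemma self_mem_subterms (t : HTerm A) : t ∈ t.subterms := by
  cases t <;> simp [subterms]

lemma subterms_subset {s t : HTerm A} (h : s ∈ t.subterms) : s.subterms ⊆ t.subterms := by
  induction t with
  | of a => rw [Set.mem_singleton_iff.1 h]
  | inf a b ha hb | sup a b ha hb | himp a b ha hb =>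
    rcases h with h | h | h
    · rw [Set.mem_singleton_iff.1 h]
    · exact (ha h).trans (Set.subset_union_left.trans Set.subset_union_right)
    · exact (hb h).trans (Set.subset_union_right.trans Set.subset_union_right)

end HTerm

lemma mem_lowerSet_himp {M : Type*} [PartialOrder M] {A B : LowerSet M} {p : M} :
    p ∈ A ⇨ B ↔ ∀ q ≤ p, q ∈ A → q ∈ B := by
  rw [← LowerSet.Iic_le, le_himp_iff]
  exact ⟨fun h q hq hA => h ⟨hq, hA⟩, fun h q hq => h q hq.1 hq.2⟩

/-! ### Finite codes for bounded bisimulation classes -/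

section Types

variable (L : Type u)

/-- Codes for the `∼_n`-classes of pointed `L`-evaluations. -/
def GameType : ℕ → Type u
  | 0 => L
  | n + 1 => Set (GameType n)

instance [Finite L] (n : ℕ) : Finite (GameType L n) := by
  induction n with
  | zero => exact inferInstanceAs (Finite L)
  | succ n ih => exact inferInstanceAs (Finite (Set (GameType L n)))

/-- Inclusion at successor levels makes `gameType f n` monotone, so that bounding it above by a code
cuts out a downset. -/
instance [PartialOrder L] : ∀ n, PartialOrder (GameType L n)
  | 0 => inferInstanceAs (PartialOrder L)
  | n + 1 => inferInstanceAs (PartialOrder (Set (GameType L n)))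

variable {L} [PartialOrder L] {M N : Type*} [PartialOrder M] [PartialOrder N]

/-- The code of the `∼_n`-class of `f` at `p`. -/
def gameType (f : M →o L) : (n : ℕ) → M → GameType L n
  | 0, p => f p
  | n + 1, p => {τ | ∃ q ≤ p, gameType f n q = τ}

/-- The two inclusions between sets of codes are the two choices of side by Player 1. The label
clause has content only at n = 0, since a win in a positive number of rounds forces it. -/
lemma gameType_eq_iff {f : M →o L} {g : N →o L} {n : ℕ} {p : M} {q : N} :
    gameType f n p = gameType g n q ↔ f p = g q ∧ Wins f g n p q := by
  induction n generalizing p q with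
  | zero => exact ⟨fun h => ⟨h, trivial⟩, fun h => h.1⟩
  | succ n ih =>
    trans Wins f g (n + 1) p q
    · constructor
      · intro h
        refine ⟨fun p' hp' => ?_, fun q' hq' => ?_⟩
        · have : gameType f n p' ∈ (show Set _ from gameType f (n + 1) p) := ⟨p', hp', rfl⟩
          rw [h] at this
          obtain ⟨q', hq', e⟩ := this
          exact ⟨q', hq', ih.1 e.symm⟩
        · have : gameType g n q' ∈ (show Set _ from gameType g (n + 1) q) := ⟨q', hq', rfl⟩
          rw [← h] at this
          obtain ⟨p', hp', e⟩ := this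
          exact ⟨p', hp', ih.1 e⟩
      · intro h
        refine Set.ext fun τ => ?_
        constructor
        · rintro ⟨p', hp', rfl⟩
          obtain ⟨q', hq', e⟩ := h.1 p' hp'
          exact ⟨q', hq', (ih.2 e).symm⟩
        · rintro ⟨q', hq', rfl⟩
          obtain ⟨p', hp', e⟩ := h.2 q' hq'
          exact ⟨p', hp', ih.2 e⟩
    · exact ⟨fun h => ⟨h.label_eq, h⟩, fun h => h.2⟩

/-- Openness says that h maps the downset of p onto the downset of h p. -/
lemma gameType_comp (f : N →o L) (h : M →o N)
    (hh : ∀ p, ∀ q ≤ h p, ∃ p' ≤ p, h p' = q) (n : ℕ) (p : M) :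
    gameType (f.comp h) n p = gameType f n (h p) := by
  induction n generalizing p with
  | zero => rfl
  | succ n ih =>
    refine Set.ext fun τ => ?_
    constructor
    · rintro ⟨q, hq, rfl⟩
      exact ⟨h q, h.monotone hq, (ih q).symm⟩
    · rintro ⟨q, hq, rfl⟩
      obtain ⟨p', hp', rfl⟩ := hh p q hq
      exact ⟨p', hp', ih p'⟩

end Types

/-! ### Evaluation at finite models -/

section Eval

variable {L : Type u} [PartialOrder L]

lemma bisim_iff_gameType {n : ℕ} {P Q : FinRootedPoset.{v}} {a : P →o L} {b : Q →o L} :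
    Bisim n a b ↔ gameType a n ⊤ = gameType b n ⊤ := by
  rw [bisim_iff, gameType_eq_iff]

lemma gameType_restr {M : Type v} [PartialOrder M] [Finite M] (f : M →o L) (p : M) (n : ℕ) :
    gameType (restr f p) n ⊤ = gameType f n p :=
  gameType_comp f (M := Set.Iic p) ⟨Subtype.val, fun _ _ h => h⟩
    (fun x y hy => ⟨⟨y, le_trans hy x.2⟩, hy, rfl⟩) n ⊤

lemma HasBIndex.mem_iff {n : ℕ} {S : Subfunctor (evalPresheaf.{u, v} L)} (hS : HasBIndex n S)
    {P Q : FinRootedPoset.{v}} {a : P →o L} {b : Q →o L}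
    (h : gameType a n ⊤ = gameType b n ⊤) : a ∈ S.obj (op P) ↔ b ∈ S.obj (op Q) :=
  ⟨fun ha => hS _ _ _ _ ha (bisim_iff_gameType.2 h),
    fun hb => hS _ _ _ _ hb (bisim_iff_gameType.2 h.symm)⟩

/-- Both sides concern evaluations with the same code at every level, so a b-index of X identifies
them. -/
lemma mem_ev_comp (X : BSub.{u, v} L) {P : FinRootedPoset.{v}} {M : Type v} [PartialOrder M]
    [Finite M] (f : M →o L) (h : P →o M) (hh : ∀ p, ∀ q ≤ h p, ∃ p' ≤ p, h p' = q) :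
    f.comp h ∈ X.1.obj (op P) ↔ h ⊤ ∈ ev f X := by
  obtain ⟨n, hn⟩ := X.2
  exact hn.mem_iff ((gameType_comp f h hh n ⊤).trans (gameType_restr f (h ⊤) n).symm)

lemma mem_obj_iff (X : BSub.{u, v} L) {P : FinRootedPoset.{v}} (a : P →o L) :
    a ∈ X.1.obj (op P) ↔ ⊤ ∈ ev a X :=
  mem_ev_comp X a OrderHom.id (fun _ q hq => ⟨q, hq, rfl⟩)

lemma le_of_ev_le {X Y : BSub.{u, v} L}
    (h : ∀ P : FinRootedPoset.{v}, ∀ a : P →o L, ev a X ≤ ev a Y) : X ≤ Y := by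
  intro U a ha
  exact (mem_obj_iff Y (P := U.unop) a).2 (h U.unop a ((mem_obj_iff X (P := U.unop) a).1 ha))

/-- `ev_f` as a Heyting homomorphism. -/
def evHom {M : Type v} [PartialOrder M] [Finite M] (f : M →o L) :
    HeytingHom (BSub.{u, v} L) (LowerSet M) where
  toFun := ev f
  map_sup' _ _ := rfl
  map_inf' _ _ := rfl
  map_bot' := rfl
  map_himp' X Y := by
    ext p
    rw [SetLike.mem_coe, SetLike.mem_coe, mem_lowerSet_himp]
    constructor
    · intro h q hq hX
      exact h (op (down q)) (downIncl hq).op hX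
    -- Presheaf implication quantifies over all open maps into ↓p, implication in D(M) only over
    -- points below p: an open map is traded for the image of its root.
    · intro h V i hX
      let k : V.unop ⟶ down p := i.unop
      have open_val : ∀ x, ∀ y ≤ (k.toOrderHom x).1, ∃ x' ≤ x, (k.toOrderHom x').1 = y := by
        intro x y hy
        obtain ⟨x', hx', e⟩ := k.isOpen x ⟨y, le_trans hy (k.toOrderHom x).2⟩ hy
        exact ⟨x', hx', congrArg Subtype.val e⟩
      let k' : V.unop →o M := ⟨fun x => (k.toOrderHom x).1, fun _ _ hxy => k.toOrderHom.monotone hxy⟩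
      exact (mem_ev_comp Y f k' open_val).2
        (h _ (k.toOrderHom ⊤).2 ((mem_ev_comp X f k' open_val).1 hX))

lemma ev_iota {M : Type v} [PartialOrder M] [Finite M] (f : M →o L) (d : LowerSet L) :
    ev f (iota L d) = downsetMap f d := rfl

lemma ev_eval_iota {M : Type v} [PartialOrder M] [Finite M] (f : M →o L)
    (t : HTerm (LowerSet L)) :
    ev f (t.eval (iota.{u, v} L)) = t.eval (downsetMap f) :=
  HTerm.map_eval (evHom f) _ t

end Eval

/-! ### Definability of bisimulation classes by terms -/

section Definability

variable {L : Type u} [PartialOrder L]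

/-- A property of pointed `L`-evaluations is definable if it is the Kripke semantics of a term. -/
def Definable (D : ∀ (M : Type v) [PartialOrder M] [Finite M], (M →o L) → M → Prop) : Prop :=
  ∃ t : HTerm (LowerSet L), ∀ (M : Type v) [PartialOrder M] [Finite M] (f : M →o L) (p : M),
    p ∈ t.eval (downsetMap f) ↔ D M f p

lemma Definable.of (d : LowerSet L) : Definable.{u, v} (L := L) fun _ _ _ f p => f p ∈ d :=
  ⟨.of d, fun _ _ _ _ _ => Iff.rfl⟩

lemma Definable.congr {D E : ∀ (M : Type v) [PartialOrder M] [Finite M], (M →o L) → M → Prop}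
    (hD : Definable D)
    (h : ∀ (M : Type v) [PartialOrder M] [Finite M] (f : M →o L) (p : M), D M f p ↔ E M f p) :
    Definable E :=
  hD.imp fun _ ht M _ _ f p => (ht M f p).trans (h M f p)

lemma Definable.himp {D E : ∀ (M : Type v) [PartialOrder M] [Finite M], (M →o L) → M → Prop}
    (hD : Definable D) (hE : Definable E) :
    Definable fun M _ _ f p => ∀ q ≤ p, D M f q → E M f q := by
  obtain ⟨s, hs⟩ := hD
  obtain ⟨t, ht⟩ := hE
  refine ⟨.himp s t, fun M _ _ f p => ?_⟩
  simp only [HTerm.eval, mem_lowerSet_himp, hs, ht]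

lemma Definable.forall_mem {ι : Type*} {s : Set ι} (hs : s.Finite)
    {D : ι → ∀ (M : Type v) [PartialOrder M] [Finite M], (M →o L) → M → Prop}
    (hD : ∀ i ∈ s, Definable (D i)) : Definable fun M _ _ f p => ∀ i ∈ s, D i M f p := by
  induction s, hs using Set.Finite.induction_on with
  | empty => exact (Definable.of ⊤).congr fun M _ _ f p => by simp
  | @insert i s _ _ ih =>
    obtain ⟨t, ht⟩ := hD i (Set.mem_insert _ _)
    obtain ⟨r, hr⟩ := ih fun j hj => hD j (Set.mem_insert_of_mem _ hj)
    refine ⟨.inf t r, fun M _ _ f p => ?_⟩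
    simp only [HTerm.eval, LowerSet.mem_inf_iff, ht, hr, Set.forall_mem_insert]

lemma Definable.exists_mem {ι : Type*} {s : Set ι} (hs : s.Finite)
    {D : ι → ∀ (M : Type v) [PartialOrder M] [Finite M], (M →o L) → M → Prop}
    (hD : ∀ i ∈ s, Definable (D i)) : Definable fun M _ _ f p => ∃ i ∈ s, D i M f p := by
  induction s, hs using Set.Finite.induction_on with
  | empty => exact (Definable.of ⊥).congr fun M _ _ f p => by simp
  | @insert i s _ _ ih =>
    obtain ⟨t, ht⟩ := hD i (Set.mem_insert _ _)
    obtain ⟨r, hr⟩ := ih fun j hj => hD j (Set.mem_insert_of_mem _ hj)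
    refine ⟨.sup t r, fun M _ _ f p => ?_⟩
    simp only [HTerm.eval, LowerSet.mem_sup_iff, ht, hr, Set.exists_mem_insert]

/-- By antisymmetry, avoiding τ everywhere below p is the implication from the first property to the
second. -/
lemma Definable.gameType_ne {n : ℕ} {τ : GameType L n}
    (hle : Definable.{u, v} fun _ _ _ f p => gameType f n p ≤ τ)
    (hge : Definable.{u, v} fun _ _ _ f p => ¬ τ ≤ gameType f n p) :
    Definable.{u, v} fun _ _ _ f p => ∀ q ≤ p, gameType f n q ≠ τ :=
  (hle.himp hge).congr fun _ _ _ _ _ => forall₂_congr fun _ _ =>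
    ⟨fun h e => h e.le e.ge, fun h h₁ h₂ => h (le_antisymm h₁ h₂)⟩

/-- At level n + 1, a code lies below τ iff no σ outside τ is realised below p, and fails to lie
above τ iff some σ in τ is not realised below p. Both are finite combinations of
`Definable.gameType_ne` at level n. -/
lemma definable_gameType [Finite L] (n : ℕ) (τ : GameType L n) :
    Definable.{u, v} (fun _ _ _ f p => gameType f n p ≤ τ) ∧
      Definable.{u, v} (fun _ _ _ f p => ¬ τ ≤ gameType f n p) := by
  induction n with
  | zero =>
    exact ⟨Definable.of (LowerSet.Iic (α := L) τ),
      Definable.of (⟨{x : L | ¬ @LE.le L _ τ x}, fun _ _ hyx hx h => hx (le_trans h hyx)⟩)⟩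
  | succ n ih =>
    have hne (σ : GameType L n) := Definable.gameType_ne (ih σ).1 (ih σ).2
    constructor
    · refine (Definable.forall_mem (s := {σ : GameType L n | σ ∉ (show Set _ from τ)})
        (Set.toFinite _) fun σ _ => hne σ).congr fun M _ _ f p => ?_
      constructor
      · rintro h _ ⟨q, hq, rfl⟩
        by_contra hσ
        exact h _ hσ q hq rfl
      · rintro h σ hσ q hq rfl
        exact hσ (h ⟨q, hq, rfl⟩)
    · refine (Definable.exists_mem (s := (show Set (GameType L n) from τ))
        (Set.toFinite _) fun σ _ => hne σ).congr fun M _ _ f p => ?_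
      constructor
      · rintro ⟨σ, hσ, h⟩ hle
        obtain ⟨q, hq, e⟩ := hle hσ
        exact h q hq e
      · intro h
        obtain ⟨σ, hσ, hσ'⟩ := Set.not_subset.1 h
        exact ⟨σ, hσ, fun q hq e => hσ' ⟨q, hq, e⟩⟩

/-- `S(h_L)` is generated as a Heyting algebra by the image of `ι_L`. -/
theorem exists_eval_iota_eq [Finite L] (X : BSub.{u, v} L) :
    ∃ t : HTerm (LowerSet L), t.eval (iota.{u, v} L) = X := by
  obtain ⟨n, hn⟩ := X.2
  -- Level n + 1 exceeds the b-index by one: inclusion of codes there gives equality of level-n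
  -- codes with some point q below the root of a member a, and X contains the restriction of a to
  -- ↓q.
  obtain ⟨t, ht⟩ := Definable.exists_mem.{u, v} (L := L)
    (s := {τ : GameType L (n + 1) | ∃ (P : FinRootedPoset.{v}) (a : P →o L),
      a ∈ X.1.obj (op P) ∧ gameType a (n + 1) ⊤ = τ}) (Set.toFinite _)
    fun τ _ => (definable_gameType (n + 1) τ).1
  have key (M : Type v) [PartialOrder M] [Finite M] (f : M →o L) :
      ev f (t.eval (iota L)) = ev f X := by
    ext p
    rw [ev_eval_iota, SetLike.mem_coe, SetLike.mem_coe, ht]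
    constructor
    · rintro ⟨_, ⟨P, a, ha, rfl⟩, hle⟩
      obtain ⟨q, -, e⟩ := hle ⟨p, le_rfl, rfl⟩
      have hq : restr a q ∈ X.1.obj (op (down q)) := X.1.map (downInclTop q).op ha
      refine (hn.mem_iff ?_).1 hq
      rw [gameType_restr, gameType_restr, e]
    · exact fun hp => ⟨_, ⟨down p, restr f p, hp, rfl⟩, (gameType_restr f p (n + 1)).ge⟩
  exact ⟨t, le_antisymm (le_of_ev_le fun P a => (key P a).le)
    (le_of_ev_le fun P a => (key P a).ge)⟩

end Definability

/-! ### Prime ideals as worlds, where an element holds when it lies outside the ideal -/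

section PrimeIdeals

/-- The complement of J is a filter; together with a it generates a filter missing b, and a prime
ideal containing b and disjoint from that filter is as required. -/
lemma exists_prime_of_not_le {H : Type*} [DistribLattice H] [BoundedOrder H] {a b : H}
    (J : Order.Ideal H) [J.IsPrime] (h : ∀ c, c ∉ J → ¬ c ⊓ a ≤ b) :
    ∃ K : Order.Ideal H, K.IsPrime ∧ K ≤ J ∧ a ∉ K ∧ b ∈ K := by
  let F : Order.PFilter H := Order.IsPFilter.toPFilter (F := {x | ∃ c ∉ J, c ⊓ a ≤ x}) <| by
    have hJ : ∃ c, c ∉ J := ⟨⊤, Order.Ideal.IsProper.top_notMem inferInstance⟩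
    refine Order.IsPFilter.of_def (hJ.imp fun c hc => ⟨c, hc, inf_le_left⟩) ?_ ?_
    · rintro x ⟨c, hc, hx⟩ y ⟨d, hd, hy⟩
      refine ⟨x ⊓ y, ⟨c ⊓ d, fun hcd => ?_, ?_⟩, inf_le_left, inf_le_right⟩
      · exact (Order.Ideal.IsPrime.mem_or_mem inferInstance hcd).elim hc hd
      · exact le_inf ((inf_le_inf_right a inf_le_left).trans hx)
          ((inf_le_inf_right a inf_le_right).trans hy)
    · rintro x y hxy ⟨c, hc, hx⟩
      exact ⟨c, hc, hx.trans hxy⟩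
  have hF {x : H} : x ∈ F ↔ ∃ c ∉ J, c ⊓ a ≤ x := Iff.rfl
  obtain ⟨K, hK, hbK, hFK⟩ := DistribLattice.prime_ideal_of_disjoint_filter_ideal (F := F)
    (I := Order.Ideal.principal b) <| Set.disjoint_left.2 fun x hx hxb => by
      obtain ⟨c, hc, hcx⟩ := hF.1 hx
      exact h c hc (hcx.trans hxb)
  have hFK' {x : H} (c : H) (hc : c ∉ J) (hx : c ⊓ a ≤ x) : x ∉ K := fun hxK =>
    Set.disjoint_left.1 hFK (hF.2 ⟨c, hc, hx⟩) hxK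
  refine ⟨K, hK, fun x hx => ?_, ?_, hbK (Order.Ideal.mem_principal.2 le_rfl)⟩
  · by_contra hxJ
    exact hFK' x hxJ inf_le_left hx
  · exact hFK' ⊤ (Order.Ideal.IsProper.top_notMem inferInstance) inf_le_right

lemma exists_prime_le_of_himp_mem {H : Type*} [HeytingAlgebra H] {a b : H} {J : Order.Ideal H}
    (hJ : J.IsPrime) (h : a ⇨ b ∈ J) :
    ∃ K : Order.Ideal H, K.IsPrime ∧ K ≤ J ∧ a ∉ K ∧ b ∈ K :=
  exists_prime_of_not_le J fun _ hc hab => hc (J.lower (le_himp_iff.2 hab) h)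

lemma exists_prime_separating {H : Type*} [DistribLattice H] {a b : H} (h : ¬ a ≤ b) :
    ∃ K : Order.Ideal H, K.IsPrime ∧ a ∉ K ∧ b ∈ K := by
  obtain ⟨K, hK, hbK, hFK⟩ := DistribLattice.prime_ideal_of_disjoint_filter_ideal
    (F := Order.PFilter.principal a) (I := Order.Ideal.principal b) <|
      Set.disjoint_left.2 fun x hx hxb => h (le_trans (b := x) hx hxb)
  exact ⟨K, hK, fun ha => Set.disjoint_left.1 hFK (Order.PFilter.mem_principal.2 le_rfl) ha,
    hbK (Order.Ideal.mem_principal.2 le_rfl)⟩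

/-- A prime ideal pulled back to the downsets of a finite poset `L` comes from a point of `L`. -/
lemma exists_point_of_prime {L H : Type*} [PartialOrder L] [Finite L] [DistribLattice H]
    [BoundedOrder H] (g : BoundedLatticeHom (LowerSet L) H) {J : Order.Ideal H} (hJ : J.IsPrime) :
    ∃ x : L, ∀ d : LowerSet L, g d ∉ J ↔ x ∈ d := by
  have hsup {s : Set L} (hs : s.Finite) (h : ∀ x ∈ s, g (LowerSet.Iic x) ∈ J) :
      g (lowerClosure s) ∈ J := by
    induction s, hs using Set.Finite.induction_on with
    | empty => simp
    | @insert x s _ _ ih =>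
      rw [Set.insert_eq, lowerClosure_union, lowerClosure_singleton, map_sup]
      exact Order.Ideal.sup_mem (h x (Set.mem_insert _ _))
        (ih fun y hy => h y (Set.mem_insert_of_mem _ hy))
  have hinf {s : Set (LowerSet L)} (hs : s.Finite) (h : ∀ d ∈ s, g d ∉ J) : g (sInf s) ∉ J := by
    induction s, hs using Set.Finite.induction_on with
    | empty => simpa using Order.Ideal.IsProper.top_notMem inferInstance
    | @insert x s _ _ ih =>
      rw [sInf_insert, map_inf]
      exact fun hJ' => (hJ.mem_or_mem hJ').elim (h x (Set.mem_insert _ _))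
        (ih fun y hy => h y (Set.mem_insert_of_mem _ hy))
  -- The least downset that holds at J is a finite union of principal ones, so one of them holds;
  -- its generator is the required point.
  have h₀ : g (sInf {d | g d ∉ J}) ∉ J := hinf (Set.toFinite _) fun _ h => h
  have h₁ : ∃ x ∈ sInf {d | g d ∉ J}, g (LowerSet.Iic x) ∉ J := by
    by_contra! h
    have := hsup (Set.toFinite (sInf {d | g d ∉ J} : LowerSet L)) h
    rw [LowerSet.lowerClosure] at this
    exact h₀ this
  obtain ⟨x, hx, hxJ⟩ := h₁
  exact ⟨x, fun d => ⟨fun hd => (sInf_le (a := d) hd) hx, fun hd hdJ =>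
    hxJ (J.lower (OrderHomClass.mono g (LowerSet.Iic_le.2 hd)) hdJ)⟩⟩

end PrimeIdeals

/-! ### Filtration and the finite model property -/

section Filtration

variable {A : Type u} {H : Type w} [HeytingAlgebra H]

/-- The worlds of the filtration of the prime spectrum of `H` through a set `S` of terms: the sets
of terms of `S` that hold at some prime ideal, ordered by reverse inclusion. -/
def World (S : Set (HTerm A)) (g : A → H) : Type u :=
  {T : (Set (HTerm A))ᵒᵈ // ∃ J : Order.Ideal H, J.IsPrime ∧
    OrderDual.ofDual T = {r ∈ S | r.eval g ∉ J}}

variable {S : Set (HTerm A)} {g : A → H}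

instance : PartialOrder (World S g) := inferInstanceAs (PartialOrder (Subtype _))

namespace World

/-- A term of `S` holds at a world. -/
def Holds (x : World S g) (r : HTerm A) : Prop := r ∈ OrderDual.ofDual x.1

lemma le_iff {x y : World S g} : x ≤ y ↔ ∀ r, y.Holds r → x.Holds r := Iff.rfl

lemma finite (hS : S.Finite) : Finite (World S g) := by
  have : Finite {T : Set (HTerm A) // T ⊆ S} := hS.finite_subsets
  refine Finite.of_injective (β := {T : Set (HTerm A) // T ⊆ S})
    (fun x => ⟨OrderDual.ofDual x.1, ?_⟩) ?_
  · obtain ⟨J, -, e⟩ := x.2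
    rw [e]
    exact Set.sep_subset _ _
  · intro x y h
    exact Subtype.ext (Subtype.mk.inj h)

/-- The world of a prime ideal. -/
def ofPrime (S : Set (HTerm A)) (g : A → H) {J : Order.Ideal H} (hJ : J.IsPrime) : World S g :=
  ⟨OrderDual.toDual {r ∈ S | r.eval g ∉ J}, J, hJ, rfl⟩

lemma holds_ofPrime {J : Order.Ideal H} (hJ : J.IsPrime) {r : HTerm A} (hr : r ∈ S) :
    (ofPrime S g hJ).Holds r ↔ r.eval g ∉ J :=
  ⟨fun h => h.2, fun h => ⟨hr, h⟩⟩

lemma exists_eq_ofPrime (x : World S g) :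
    ∃ (J : Order.Ideal H) (hJ : J.IsPrime), x = ofPrime S g hJ := by
  obtain ⟨J, hJ, e⟩ := x.2
  exact ⟨J, hJ, Subtype.ext e⟩

lemma ofPrime_le {J K : Order.Ideal H} (hJ : J.IsPrime) (hK : K.IsPrime) (h : K ≤ J) :
    ofPrime S g hK ≤ ofPrime S g hJ :=
  le_iff.2 fun _ hr => ⟨hr.1, fun hrK => hr.2 (h hrK)⟩

end World

variable {L : Type u} [PartialOrder L]

lemma exists_point_of_world [Finite L] {S : Set (HTerm (LowerSet L))} (hS : ∀ d, HTerm.of d ∈ S)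
    {g : BoundedLatticeHom (LowerSet L) H} (x : World S g) :
    ∃ l : L, ∀ d, l ∈ d ↔ x.Holds (.of d) := by
  obtain ⟨J, hJ, rfl⟩ := x.exists_eq_ofPrime
  obtain ⟨l, hl⟩ := exists_point_of_prime g hJ
  exact ⟨l, fun d => ((World.holds_ofPrime hJ (hS d)).trans (hl d)).symm⟩

/-- The truth lemma of the filtration. In the implication case, `exists_prime_le_of_himp_mem`
supplies a lower world refuting a false implication; the converse is modus ponens at the lower
world. -/
lemma mem_eval_iff_holds {S : Set (HTerm (LowerSet L))}
    (hS : ∀ t ∈ S, t.subterms ⊆ S) {g : BoundedLatticeHom (LowerSet L) H} {f : World S g →o L}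
    (hf : ∀ x d, f x ∈ d ↔ x.Holds (.of d)) {t : HTerm (LowerSet L)} (ht : t ∈ S)
    (x : World S g) : x ∈ t.eval (downsetMap f) ↔ x.Holds t := by
  have sub {r : HTerm (LowerSet L)} (hr : r ∈ S) {s} (hs : s ∈ r.subterms) : s ∈ S := hS r hr hs
  induction t generalizing x with
  | of d => exact hf x d
  | inf s t ihs iht =>
    have hs := sub ht (Or.inr (Or.inl s.self_mem_subterms))
    have ht' := sub ht (Or.inr (Or.inr t.self_mem_subterms))
    obtain ⟨J, hJ, rfl⟩ := x.exists_eq_ofPrime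
    simp only [HTerm.eval, LowerSet.mem_inf_iff, ihs hs, iht ht']
    rw [World.holds_ofPrime hJ hs,
      World.holds_ofPrime hJ ht', World.holds_ofPrime hJ ht, HTerm.eval]
    refine ⟨fun h hst => (hJ.mem_or_mem hst).elim h.1 h.2, fun h => ⟨fun hs => h ?_, fun ht => h ?_⟩⟩
    · exact J.lower inf_le_left hs
    · exact J.lower inf_le_right ht
  | sup s t ihs iht =>
    have hs := sub ht (Or.inr (Or.inl s.self_mem_subterms))
    have ht' := sub ht (Or.inr (Or.inr t.self_mem_subterms))
    obtain ⟨J, hJ, rfl⟩ := x.exists_eq_ofPrime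
    simp only [HTerm.eval, LowerSet.mem_sup_iff, ihs hs, iht ht']
    rw [World.holds_ofPrime hJ hs,
      World.holds_ofPrime hJ ht', World.holds_ofPrime hJ ht, HTerm.eval, Order.Ideal.sup_mem_iff,
      not_and_or]
  | himp s t ihs iht =>
    have hs := sub ht (Or.inr (Or.inl s.self_mem_subterms))
    have ht' := sub ht (Or.inr (Or.inr t.self_mem_subterms))
    simp only [HTerm.eval, mem_lowerSet_himp, ihs hs, iht ht']
    constructor
    · intro h
      obtain ⟨J, hJ, rfl⟩ := x.exists_eq_ofPrime
      rw [World.holds_ofPrime hJ ht]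
      intro hst
      obtain ⟨K, hK, hKJ, hsK, htK⟩ := exists_prime_le_of_himp_mem hJ hst
      exact (World.holds_ofPrime hK ht').1 (h _ (World.ofPrime_le hJ hK hKJ)
        ((World.holds_ofPrime hK hs).2 hsK)) htK
    · intro h y hy hys
      have hyst := World.le_iff.1 hy _ h
      obtain ⟨J, hJ, rfl⟩ := y.exists_eq_ofPrime
      rw [World.holds_ofPrime hJ ht']
      rw [World.holds_ofPrime hJ hs] at hys
      rw [World.holds_ofPrime hJ ht, HTerm.eval] at hyst
      intro htJ
      refine (hJ.mem_or_mem (J.lower ?_ htJ)).elim hys hyst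
      exact inf_himp_le

/-- Finite model property for Heyting algebras over a finite distributive lattice `D(L)`. -/
lemma exists_finite_countermodel [Finite L] (g : BoundedLatticeHom (LowerSet L) H)
    {s t : HTerm (LowerSet L)} (h : ¬ s.eval g ≤ t.eval g) :
    ∃ (M : Type u) (_ : PartialOrder M) (_ : Finite M) (f : M →o L),
      ¬ s.eval (downsetMap f) ≤ t.eval (downsetMap f) := by
  let S : Set (HTerm (LowerSet L)) := s.subterms ∪ t.subterms ∪ Set.range HTerm.of
  have hs : s ∈ S := Or.inl (Or.inl s.self_mem_subterms)
  have ht : t ∈ S := Or.inl (Or.inr t.self_mem_subterms)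
  have hS : ∀ t ∈ S, t.subterms ⊆ S := by
    rintro r ((hr | hr) | ⟨d, rfl⟩)
    · exact (HTerm.subterms_subset hr).trans fun _ h => Or.inl (Or.inl h)
    · exact (HTerm.subterms_subset hr).trans fun _ h => Or.inl (Or.inr h)
    · rintro _ rfl
      exact Or.inr ⟨d, rfl⟩
  have hfin : Finite (World S g) := World.finite
    ((s.finite_subterms.union t.finite_subterms).union (Set.finite_range _))
  choose F hF using exists_point_of_world (S := S) (g := g) fun d => Or.inr ⟨d, rfl⟩
  let f : World S g →o L := ⟨F, fun x y hxy =>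
    (hF x (LowerSet.Iic (F y))).2 (World.le_iff.1 hxy _ ((hF y _).1 le_rfl))⟩
  obtain ⟨J, hJ, hsJ, htJ⟩ := exists_prime_separating h
  refine ⟨World S g, inferInstance, hfin, f, fun hle => ?_⟩
  have := hle ((mem_eval_iff_holds hS (f := f) hF hs (World.ofPrime S g hJ)).2
    ((World.holds_ofPrime hJ hs).2 hsJ))
  exact (World.holds_ofPrime hJ ht).1 ((mem_eval_iff_holds hS (f := f) hF ht _).1 this) htJ

lemma eval_downsetMap_le_of_orderIso {M : Type*} {N : Type*} [PartialOrder M] [PartialOrder N]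
    (e : M ≃o N) (f : M →o L) {s t : HTerm (LowerSet L)}
    (h : s.eval (downsetMap (f.comp (e.symm : N →o M))) ≤
      t.eval (downsetMap (f.comp (e.symm : N →o M)))) :
    s.eval (downsetMap f) ≤ t.eval (downsetMap f) := by
  have hmap (d : LowerSet L) :
      LowerSet.map e.symm (downsetMap (f.comp (e.symm : N →o M)) d) = downsetMap f d := by
    ext p
    rw [SetLike.mem_coe, LowerSet.mem_map]
    change f (e.symm (e p)) ∈ d ↔ f p ∈ d
    rw [e.symm_apply_apply]
  have := (LowerSet.map e.symm).monotone h
  rwa [HTerm.map_eval, HTerm.map_eval, funext hmap] at this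

/-- An inequality between terms that holds in `S(h_L)` holds in every Heyting algebra. -/
theorem eval_le_eval_of_eval_iota_le [Finite L] (g : BoundedLatticeHom (LowerSet L) H)
    {s t : HTerm (LowerSet L)} (h : s.eval (iota.{u, v} L) ≤ t.eval (iota.{u, v} L)) :
    s.eval g ≤ t.eval g := by
  by_contra hg
  obtain ⟨M, _, _, f, hf⟩ := exists_finite_countermodel g hg
  -- The countermodel lives in the universe of L; being finite, it has a copy in `Type v`, where
  -- `ev` applies.
  have : Small.{v} M := Countable.toSmall M
  have : Finite (Shrink.{v} M) := Finite.of_equiv M (equivShrink.{v} M)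
  refine hf (eval_downsetMap_le_of_orderIso (orderIsoShrink.{v} M) f ?_)
  rw [← ev_eval_iota, ← ev_eval_iota]
  exact OrderHomClass.mono (evHom _) h

lemma eval_eq_eval_of_eval_iota_eq [Finite L] (g : BoundedLatticeHom (LowerSet L) H)
    {s t : HTerm (LowerSet L)} (h : s.eval (iota.{u, v} L) = t.eval (iota.{u, v} L)) :
    s.eval g = t.eval g :=
  le_antisymm (eval_le_eval_of_eval_iota_le g h.le) (eval_le_eval_of_eval_iota_le g h.ge)

end Filtration

/-! ### The universal property -/

section Free

variable {L : Type u} [PartialOrder L]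

lemma iota_injective : Function.Injective (iota.{u, v} L) := by
  intro d e h
  ext x
  -- One-point models already separate the downsets of L.
  let c : PUnit.{v + 1} →o L := ⟨fun _ => x, fun _ _ _ => le_rfl⟩
  have hc : downsetMap c d = downsetMap c e := by rw [← ev_iota, ← ev_iota, h]
  exact SetLike.ext_iff.1 hc PUnit.unit

variable [Finite L] {H : Type w} [HeytingAlgebra H]

/-- The extension of `g : D(L) → H` to a Heyting homomorphism `S(h_L) → H`. -/
noncomputable def lift (g : BoundedLatticeHom (LowerSet L) H) :
    HeytingHom (BSub.{u, v} L) H :=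
  have key {X : BSub.{u, v} L} {t : HTerm (LowerSet L)} (h : X = t.eval (iota L)) :
      (exists_eval_iota_eq X).choose.eval g = t.eval g :=
    eval_eq_eval_of_eval_iota_eq g ((exists_eval_iota_eq X).choose_spec.trans h)
  { toFun X := (exists_eval_iota_eq X).choose.eval g
    map_sup' X Y := key (t := .sup _ _) <| by
      rw [HTerm.eval, (exists_eval_iota_eq X).choose_spec, (exists_eval_iota_eq Y).choose_spec]
    map_inf' X Y := key (t := .inf _ _) <| by
      rw [HTerm.eval, (exists_eval_iota_eq X).choose_spec, (exists_eval_iota_eq Y).choose_spec]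
    map_himp' X Y := key (t := .himp _ _) <| by
      rw [HTerm.eval, (exists_eval_iota_eq X).choose_spec, (exists_eval_iota_eq Y).choose_spec]
    -- Terms have no constant for the bottom; the generator ⊥ of D(L) replaces it, as `iota` and g
    -- preserve bottom.
    map_bot' := (key (t := .of ⊥) (map_bot (iota L)).symm).trans (map_bot g) }

lemma lift_eval (g : BoundedLatticeHom (LowerSet L) H) (t : HTerm (LowerSet L)) :
    lift.{u, v} g (t.eval (iota L)) = t.eval g :=
  eval_eq_eval_of_eval_iota_eq g (exists_eval_iota_eq (t.eval (iota L))).choose_spec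

end Free

end HeytingEval

theorem mainTheorem3 (L : Type u) [PartialOrder L] [Finite L] :
    (∀ (M : Type v) [PartialOrder M] [Finite M] (f : M →o L),
      ∃ φ : HeytingHom (HeytingEval.BSub.{u, v} L) (LowerSet M),
        ⇑φ = HeytingEval.ev f ∧
        ∀ d : LowerSet L, HeytingEval.ev f (HeytingEval.iota L d) = HeytingEval.downsetMap f d) ∧
    Function.Injective (HeytingEval.iota.{u, v} L) ∧
    (∀ (H : Type w) [HeytingAlgebra H] (g : BoundedLatticeHom (LowerSet L) H),
      ∃! φ : HeytingHom (HeytingEval.BSub.{u, v} L) H,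
        ∀ d : LowerSet L, φ (HeytingEval.iota L d) = g d) := by
  refine ⟨fun M _ _ f => ⟨HeytingEval.evHom f, rfl, HeytingEval.ev_iota f⟩,
    HeytingEval.iota_injective, fun H _ g =>
      ⟨HeytingEval.lift g, fun d => HeytingEval.lift_eval g (.of d), fun ψ hψ => ?_⟩⟩
  ext X
  obtain ⟨t, rfl⟩ := HeytingEval.exists_eval_iota_eq X
  rw [HeytingEval.HTerm.map_eval, HeytingEval.lift_eval, funext hψ]
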